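/- Let $k\ge 1$ be an integer, $d_k=k+1$, $\gamma\in\mathbb R$, $\rho=\gamma(k+2)$ and $\lambda_h>0$. Let $\mathcal H_{(k,\rho)}$ be the Hilbert space of the principal series unitary representation $D^{(k,\rho)}$ of $\mathrm{SL}(2,\mathbb C)$: it consists of the (classes of measurable) functions $F$ on $\mathbb C^2\setminus\{0\}$ with $F(tz)=t^{\,i\rho/2-1+k/2}\,\bar t^{\,i\rho/2-1-k/2}F(z)$ for $t\in\mathbb C\setminus\{0\}$ and $\int_{\mathbb C}|F(z,1)|^2\,d^2z<\infty$ (this integral being the squared norm), on which $g$ acts by $(D^{(k,\rho)}(g)F)(z_1,z_2)=F((z_1,z_2)g)$. Let $\mathcal H_k\subset\mathcal H_{(k,\rho)}$ be the $d_k$-dimensional subspace carrying the spin-$k/2$ representation of $\mathrm{SU}(2)$, i.e. the space of the functions $(|z_1|^2+|z_2|^2)^{i\rho/2-1-k/2}\,p(z_1,z_2)$ with $p$ a homogeneous polynomial of degree $k$, and let $P_k$ be the orthogonal projection of $\mathcal H_{(k,\rho)}$ onto $\mathcal H_k$. Let $h$ be an internal face whose oriented boundary $\partial h$ is a closed path through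 $n\ge 1$ vertices $v$. For each such $v$ let $e$ and $e'$ be the edges of $\partial h$ that enter and leave $v$, and let $g_{ve},g_{ve'}\in\mathrm{SL}(2,\mathbb C)$ be arbitrary. Put $$\zeta_k^{(h)}=\lambda_h\,d_k\,\mathrm{Tr}_{\mathcal H_{(k,\rho)}}\Big[\overrightarrow{\prod_{v\in\partial h}}P_k\,D^{(k,\rho)}(g_{ve}^{-1}g_{ve'})\,P_k\Big],$$ where the product is ordered along $\partial h$. Then $$|\zeta_k^{(h)}|\le\lambda_h d_k^2,$$ and equality holds if and only if $g_{ve}^{-1}g_{ve'}\in\mathrm{SU}(2)$ for every vertex $v$ of $\partial h$ and $\overrightarrow{\prod}_{v\in\partial h}\,g_{ve}^{-1}g_{ve'}=\pm 1$. -/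

import Mathlib

open MeasureTheory Complex
open scoped ENNReal InnerProductSpace MatrixGroups

noncomputable section

namespace Spinfoam

/-! ### The principal series of `SL(2, ℂ)`

The representation `(k, ρ)` acts on functions `F` on `ℂ² ∖ {0}` with
`F (t z₁, t z₂) = t ^ (iρ/2 - 1 + k/2) * conj t ^ (iρ/2 - 1 - k/2) * F (z₁, z₂)` by
`(g F) (z₁, z₂) = F ((z₁, z₂) g)` (row vector times matrix), with squared norm the integral of
`|F|²` over the projective line.  In the affine chart `f z = F (z, 1)` this is `L²(ℂ)` for Lebesgue
measure, with `(g f) z = χ (b z + d) * f ((a z + c) / (b z + d))` for `g = !![a, b; c, d]`, where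
`χ w = w ^ (iρ/2 - 1 + k/2) * conj w ^ (iρ/2 - 1 - k/2) = |w| ^ (iρ - 2 - k) * w ^ k`. -/

/-- The Hilbert space `L²(ℂ)` carrying the principal series representations. -/
abbrev PSpace : Type := Lp ℂ 2 (volume : Measure ℂ)

/-- The second component `b z + d` of `(z, 1) g`. -/
def den (g : SL(2, ℂ)) (z : ℂ) : ℂ := g 0 1 * z + g 1 1

/-- The Möbius map `z ↦ (a z + c) / (b z + d)`, i.e. the action of `g` on `[z : 1]`. -/
def mob (g : SL(2, ℂ)) (z : ℂ) : ℂ := (g 0 0 * z + g 1 0) / den g z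

/-- The homogeneity character `χ w = |w| ^ (iρ - 2 - k) * w ^ k`. -/
def chi (k : ℕ) (ρ : ℝ) (w : ℂ) : ℂ := (‖w‖ : ℂ) ^ (I * ρ - 2 - k) * w ^ k

/-- The principal series action on functions on `ℂ`. -/
def actFun (k : ℕ) (ρ : ℝ) (g : SL(2, ℂ)) (f : ℂ → ℂ) (z : ℂ) : ℂ :=
  chi k ρ (den g z) * f (mob g z)

theorem det_eq (g : SL(2, ℂ)) : g 0 0 * g 1 1 - g 0 1 * g 1 0 = 1 := by
  have := g.det_coe
  rwa [Matrix.det_fin_two] at this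

theorem null_affine (p q : ℂ) (h : p ≠ 0 ∨ q ≠ 0) : volume {z : ℂ | p * z + q = 0} = 0 := by
  refine Set.Subsingleton.measure_zero (fun x hx y hy => ?_) _
  simp only [Set.mem_ofPred_eq] at hx hy
  rcases eq_or_ne p 0 with rfl | hp
  · simp_all
  · exact mul_left_cancel₀ hp (by linear_combination hx - hy)

theorem ae_den_ne_zero (g : SL(2, ℂ)) : ∀ᵐ z : ℂ, den g z ≠ 0 := by
  have h : volume {z : ℂ | den g z = 0} = 0 := by
    refine null_affine (g 0 1) (g 1 1) ?_
    by_contra! h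
    have := det_eq g
    simp [h.1, h.2] at this
  simpa [ae_iff] using h

theorem norm_chi (k : ℕ) (ρ : ℝ) {w : ℂ} (hw : w ≠ 0) : ‖chi k ρ w‖ = (‖w‖ ^ 2)⁻¹ := by
  have h : 0 < ‖w‖ := norm_pos_iff.mpr hw
  rw [chi, norm_mul, norm_cpow_eq_rpow_re_of_pos h, norm_pow, ← Real.rpow_natCast ‖w‖ k,
    ← Real.rpow_add h]
  have : (I * (ρ : ℂ) - 2 - k).re + (k : ℝ) = -(2 : ℕ) := by simp
  rw [this, Real.rpow_neg h.le, Real.rpow_natCast]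

theorem chi_mul (k : ℕ) (ρ : ℝ) (v w : ℂ) : chi k ρ (v * w) = chi k ρ v * chi k ρ w := by
  simp only [chi, norm_mul, ofReal_mul, mul_pow]
  rw [mul_cpow_ofReal_nonneg (norm_nonneg _) (norm_nonneg _)]
  ring

theorem den_mul (g h : SL(2, ℂ)) {z : ℂ} (hz : den g z ≠ 0) :
    den (g * h) z = den g z * den h (mob g z) := by
  have e : den g z * mob g z = g 0 0 * z + g 1 0 := by rw [mob, mul_div_cancel₀ _ hz]
  have : den g z * den h (mob g z) = h 0 1 * (den g z * mob g z) + h 1 1 * den g z := by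
    simp only [den]; ring
  rw [this, e]
  simp only [den, Matrix.SpecialLinearGroup.coe_mul, Matrix.mul_apply, Fin.sum_univ_two]
  ring

theorem mob_mul (g h : SL(2, ℂ)) {z : ℂ} (hz : den g z ≠ 0) :
    mob (g * h) z = mob h (mob g z) := by
  have e : den g z * mob g z = g 0 0 * z + g 1 0 := by rw [mob, mul_div_cancel₀ _ hz]
  have e' : mob h (mob g z) = (h 0 0 * mob g z + h 1 0) / den h (mob g z) := rfl
  rw [e', ← mul_div_mul_left _ (den h (mob g z)) hz, ← den_mul g h hz, mob]
  congr 1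
  have : den g z * (h 0 0 * mob g z + h 1 0) = h 0 0 * (den g z * mob g z) + h 1 0 * den g z := by
    ring
  rw [this, e]
  simp only [den, Matrix.SpecialLinearGroup.coe_mul, Matrix.mul_apply, Fin.sum_univ_two]
  ring

theorem measurable_den (g : SL(2, ℂ)) : Measurable (den g) := by
  unfold den; fun_prop

theorem measurable_mob (g : SL(2, ℂ)) : Measurable (mob g) := by
  unfold mob den; fun_prop

theorem measurable_chi (k : ℕ) (ρ : ℝ) : Measurable (chi k ρ) := by
  unfold chi; fun_prop

theorem hasDerivAt_mob (g : SL(2, ℂ)) {z : ℂ} (hz : den g z ≠ 0) :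
    HasDerivAt (mob g) (1 / den g z ^ 2) z := by
  have h1 : HasDerivAt (fun z : ℂ => g 0 0 * z + g 1 0) (g 0 0) z := by
    simpa using ((hasDerivAt_id z).const_mul (g 0 0)).add_const (g 1 0)
  have h2 : HasDerivAt (den g) (g 0 1) z := by
    have : HasDerivAt (fun z : ℂ => g 0 1 * z + g 1 1) (g 0 1) z := by
      simpa using ((hasDerivAt_id z).const_mul (g 0 1)).add_const (g 1 1)
    exact this
  have e : 1 / den g z ^ 2 =
      (g 0 0 * den g z - (g 0 0 * z + g 1 0) * g 0 1) / den g z ^ 2 := by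
    congr 1
    rw [show den g z = g 0 1 * z + g 1 1 from rfl]
    linear_combination -det_eq g
  rw [e]
  exact h1.div h2 hz

theorem injOn_mob (g : SL(2, ℂ)) : Set.InjOn (mob g) {z | den g z ≠ 0} := by
  intro x hx y hy h
  have h1 : den g⁻¹ (mob g x) ≠ 0 := by
    intro h0
    have := den_mul g g⁻¹ hx
    rw [h0] at this
    simp [den] at this
  have key : ∀ z, den g z ≠ 0 → mob g⁻¹ (mob g z) = z := by
    intro z hz
    rw [← mob_mul g g⁻¹ hz]
    simp [mob, den]
  rw [← key x hx, ← key y hy, h]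

theorem det_restrictScalars (w : ℂ) :
    ((ContinuousLinearMap.toSpanSingleton ℂ w).restrictScalars ℝ : ℂ →L[ℝ] ℂ).det = ‖w‖ ^ 2 := by
  have : (((ContinuousLinearMap.toSpanSingleton ℂ w).restrictScalars ℝ : ℂ →L[ℝ] ℂ) :
      ℂ →ₗ[ℝ] ℂ) = Algebra.lmul ℝ ℂ w := by
    ext z; simp [mul_comm]
  rw [ContinuousLinearMap.det, this, ← Algebra.norm_apply, Algebra.norm_complex_apply,
    normSq_eq_norm_sq]

/-- Change of variables along a Möbius map. -/
theorem lintegral_mob (g : SL(2, ℂ)) (F : ℂ → ℝ≥0∞) :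
    ∫⁻ z, ENNReal.ofReal (‖1 / den g z ^ 2‖ ^ 2) * F (mob g z) = ∫⁻ z, F z := by
  have hs : MeasurableSet {z | den g z ≠ 0} := (measurable_den g) (measurableSet_singleton 0).compl
  have h := lintegral_image_eq_lintegral_abs_det_fderiv_mul volume hs (f := mob g)
    (f' := fun z => (ContinuousLinearMap.toSpanSingleton ℂ (1 / den g z ^ 2)).restrictScalars ℝ)
    (fun z hz => ((hasDerivAt_mob g hz).hasFDerivAt.restrictScalars ℝ).hasFDerivWithinAt)
    (injOn_mob g) F
  simp only [det_restrictScalars, abs_pow, abs_norm] at h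
  rw [setLIntegral_congr (t := Set.univ), setLIntegral_univ] at h
  · rw [h, setLIntegral_congr (t := Set.univ), setLIntegral_univ]
    exact Filter.eventuallyEq_univ.mpr (ae_den_ne_zero g)
  · refine Filter.eventuallyEq_univ.mpr ?_
    filter_upwards [ae_den_ne_zero g⁻¹] with w hw
    refine ⟨mob g⁻¹ w, ?_, ?_⟩
    · intro h0
      have := den_mul g⁻¹ g hw
      rw [h0] at this
      simp [den] at this
    · rw [← mob_mul g⁻¹ g hw]
      simp [mob, den]

theorem quasiMeasurePreserving_mob (g : SL(2, ℂ)) :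
    Measure.QuasiMeasurePreserving (mob g) := by
  refine ⟨measurable_mob g, Measure.AbsolutelyContinuous.mk fun s hs h0 => ?_⟩
  rw [Measure.map_apply (measurable_mob g) hs]
  have h := lintegral_mob g (s.indicator 1)
  rw [lintegral_indicator_one hs, h0, lintegral_eq_zero_iff] at h
  · rw [measure_eq_zero_iff_ae_notMem]
    filter_upwards [h, ae_den_ne_zero g] with z hz hd hm
    have hm' : mob g z ∈ s := hm
    simp [hm', hd] at hz
  · have := (measurable_den g)
    have := (measurable_one.indicator hs : Measurable (s.indicator (1 : ℂ → ℝ≥0∞))).comp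
      (measurable_mob g)
    simp only [Function.comp_def] at this
    fun_prop

theorem eLpNorm_actFun (k : ℕ) (ρ : ℝ) (g : SL(2, ℂ)) (f : ℂ → ℂ) :
    eLpNorm (actFun k ρ g f) 2 volume = eLpNorm f 2 volume := by
  rw [eLpNorm_eq_lintegral_rpow_enorm_toReal two_ne_zero ENNReal.ofNat_ne_top,
    eLpNorm_eq_lintegral_rpow_enorm_toReal two_ne_zero ENNReal.ofNat_ne_top,
    ← lintegral_mob g (fun z => ‖f z‖ₑ ^ (2 : ℝ≥0∞).toReal)]
  congr 1
  refine lintegral_congr_ae ?_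
  filter_upwards [ae_den_ne_zero g] with z hz
  rw [actFun, enorm_mul, ENNReal.mul_rpow_of_nonneg _ _ (by simp)]
  congr 1
  rw [← ofReal_norm, norm_chi k ρ hz]
  simp only [ENNReal.toReal_ofNat, ENNReal.rpow_ofNat]
  rw [← ENNReal.ofReal_pow (by positivity)]
  simp

theorem memLp_actFun (k : ℕ) (ρ : ℝ) (g : SL(2, ℂ)) {f : ℂ → ℂ} (hf : MemLp f 2 volume) :
    MemLp (actFun k ρ g f) 2 volume := by
  refine ⟨?_, by rw [eLpNorm_actFun]; exact hf.2⟩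
  exact ((measurable_chi k ρ).comp (measurable_den g)).aestronglyMeasurable.mul
    (hf.1.comp_quasiMeasurePreserving (quasiMeasurePreserving_mob g))

theorem actFun_congr (k : ℕ) (ρ : ℝ) (g : SL(2, ℂ)) {f f' : ℂ → ℂ} (h : f =ᵐ[volume] f') :
    actFun k ρ g f =ᵐ[volume] actFun k ρ g f' := by
  filter_upwards [(quasiMeasurePreserving_mob g).ae_eq_comp h] with z hz
  simp only [Function.comp_apply] at hz
  simp [actFun, hz]

/-- The operator of `g` in the principal series `(k, ρ)`. -/
def psOp (k : ℕ) (ρ : ℝ) (g : SL(2, ℂ)) : PSpace →ₗᵢ[ℂ] PSpace where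
  toFun f := (memLp_actFun k ρ g (Lp.memLp f)).toLp
  map_add' f f' := by
    ext1
    refine (MemLp.coeFn_toLp _).trans (((actFun_congr k ρ g (Lp.coeFn_add f f'))).trans ?_)
    refine Filter.EventuallyEq.trans ?_ (Lp.coeFn_add _ _).symm
    filter_upwards [MemLp.coeFn_toLp (memLp_actFun k ρ g (Lp.memLp f)),
      MemLp.coeFn_toLp (memLp_actFun k ρ g (Lp.memLp f'))] with z h1 h2
    simp [h1, h2, actFun, mul_add]
  map_smul' c f := by
    ext1
    refine (MemLp.coeFn_toLp _).trans (((actFun_congr k ρ g (Lp.coeFn_smul c f))).trans ?_)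
    refine Filter.EventuallyEq.trans ?_ (Lp.coeFn_smul _ _).symm
    filter_upwards [MemLp.coeFn_toLp (memLp_actFun k ρ g (Lp.memLp f))] with z h1
    simp [h1, actFun]
    ring
  norm_map' f := by
    simp only [LinearMap.coe_mk, AddHom.coe_mk]
    rw [Lp.norm_toLp, eLpNorm_actFun, Lp.norm_def]

theorem psOp_coeFn (k : ℕ) (ρ : ℝ) (g : SL(2, ℂ)) (f : PSpace) :
    psOp k ρ g f =ᵐ[volume] actFun k ρ g f :=
  MemLp.coeFn_toLp (memLp_actFun k ρ g (Lp.memLp f))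

theorem psOp_one (k : ℕ) (ρ : ℝ) (f : PSpace) : psOp k ρ 1 f = f := by
  ext1
  filter_upwards [psOp_coeFn k ρ 1 f] with z h
  simp [h, actFun, den, mob, chi]

theorem psOp_mul (k : ℕ) (ρ : ℝ) (g h : SL(2, ℂ)) (f : PSpace) :
    psOp k ρ (g * h) f = psOp k ρ g (psOp k ρ h f) := by
  ext1
  filter_upwards [psOp_coeFn k ρ (g * h) f, psOp_coeFn k ρ g (psOp k ρ h f),
    actFun_congr k ρ g (psOp_coeFn k ρ h f), ae_den_ne_zero g] with z h1 h2 h3 hz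
  rw [h1, h2, h3]
  simp only [actFun, den_mul g h hz, mob_mul g h hz, chi_mul, mul_assoc]

/-- The principal series unitary representation `D^{(k, ρ)}` of `SL(2, ℂ)`. -/
def principalSeries (k : ℕ) (ρ : ℝ) : SL(2, ℂ) →* (PSpace ≃ₗᵢ[ℂ] PSpace) where
  toFun g :=
    { (psOp k ρ g) with
      invFun := psOp k ρ g⁻¹
      left_inv := fun f => by
        change psOp k ρ g⁻¹ (psOp k ρ g f) = f
        rw [← psOp_mul, inv_mul_cancel, psOp_one]
      right_inv := fun f => by
        change psOp k ρ g (psOp k ρ g⁻¹ f) = f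
        rw [← psOp_mul, mul_inv_cancel, psOp_one] }
  map_one' := by
    ext1 f
    exact psOp_one k ρ f
  map_mul' g h := by
    ext1 f
    exact psOp_mul k ρ g h f

/-! ### The lowest `SU(2)`-component -/

/-- The function `(|z₁|² + |z₂|²) ^ (iρ/2 - 1 - k/2) * z₁ ^ m * z₂ ^ (k - m)` in the chart
`(z₁, z₂) = (z, 1)`. -/
def canonFun (k : ℕ) (ρ : ℝ) (m : Fin (k + 1)) (z : ℂ) : ℂ :=
  ((‖z‖ ^ 2 + 1 : ℝ) : ℂ) ^ (I * ρ / 2 - 1 - k / 2) * z ^ (m : ℕ)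

theorem memLp_canonFun (k : ℕ) (ρ : ℝ) (m : Fin (k + 1)) :
    MemLp (canonFun k ρ m) 2 volume := by
  have hpos : ∀ z : ℂ, 0 < ‖z‖ ^ 2 + 1 := fun z => by positivity
  have hmeas : AEStronglyMeasurable (canonFun k ρ m) volume := by
    refine Measurable.aestronglyMeasurable ?_
    unfold canonFun
    fun_prop
  rw [memLp_two_iff_integrable_sq_norm hmeas]
  have hint : Integrable (fun z : ℂ => ((1 : ℝ) + ‖z‖ ^ 2) ^ (-(4 : ℝ) / 2)) volume :=
    integrable_rpow_neg_one_add_norm_sq (by rw [Complex.finrank_real_complex]; norm_num)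
  refine hint.mono' (hmeas.norm.pow 2) (Filter.Eventually.of_forall fun z => ?_)
  have hN : 1 ≤ ‖z‖ ^ 2 + 1 := by nlinarith [sq_nonneg ‖z‖]
  have hre : (I * (ρ : ℂ) / 2 - 1 - k / 2).re = -1 - k / 2 := by
    simp
  rw [canonFun, norm_mul, norm_cpow_eq_rpow_re_of_pos (hpos z), hre, norm_pow z,
    mul_pow, ← Real.rpow_mul_natCast (hpos z).le, ← pow_mul ‖z‖,
    mul_comm (m : ℕ) 2, pow_mul, add_comm (1 : ℝ)]
  have hm : (‖z‖ ^ 2) ^ (m : ℕ) ≤ (‖z‖ ^ 2 + 1) ^ (k : ℝ) := by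
    rw [Real.rpow_natCast]
    calc (‖z‖ ^ 2) ^ (m : ℕ) ≤ (‖z‖ ^ 2 + 1) ^ (m : ℕ) := by gcongr; linarith
      _ ≤ (‖z‖ ^ 2 + 1) ^ k := pow_le_pow_right₀ hN (Nat.lt_succ_iff.mp m.2)
  rw [Real.norm_of_nonneg (by positivity)]
  calc _ ≤ (‖z‖ ^ 2 + 1) ^ ((-1 - (k : ℝ) / 2) * (2 : ℕ)) * (‖z‖ ^ 2 + 1) ^ (k : ℝ) :=
        mul_le_mul_of_nonneg_left hm (by positivity)
    _ = (‖z‖ ^ 2 + 1) ^ (-(4 : ℝ) / 2) := by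
      rw [← Real.rpow_add (hpos z)]
      congr 1
      push_cast
      ring

/-- The subspace `H_k` of `H_{(k, ρ)}` carrying the spin-`k/2` representation of `SU(2)`: the
functions `(|z₁|² + |z₂|²) ^ (iρ/2 - 1 - k/2) * p (z₁, z₂)` with `p` a homogeneous polynomial of
degree `k`. -/
def spinSubspace (k : ℕ) (ρ : ℝ) : Submodule ℂ PSpace :=
  Submodule.span ℂ (Set.range fun m : Fin (k + 1) => (memLp_canonFun k ρ m).toLp)

instance (k : ℕ) (ρ : ℝ) : FiniteDimensional ℂ (spinSubspace k ρ) :=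
  FiniteDimensional.span_of_finite ℂ (Set.finite_range _)

/-- `SU(2)` acts on `H_k` by linear substitution in the homogeneous polynomial, which is the
spin-`k/2` representation. -/
theorem actFun_canonFun (k : ℕ) (ρ : ℝ) (u : SL(2, ℂ))
    (hu : (u : Matrix (Fin 2) (Fin 2) ℂ) ∈ Matrix.specialUnitaryGroup (Fin 2) ℂ)
    (m : Fin (k + 1)) {z : ℂ} (hz : den u z ≠ 0) :
    actFun k ρ u (canonFun k ρ m) z =
      ((‖z‖ ^ 2 + 1 : ℝ) : ℂ) ^ (I * ρ / 2 - 1 - k / 2) *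
        ((u 0 0 * z + u 1 0) ^ (m : ℕ) * (u 0 1 * z + u 1 1) ^ (k - (m : ℕ))) := by
  have hw : 0 < ‖den u z‖ := norm_pos_iff.mpr hz
  have hN : ‖den u z‖ ^ 2 * (‖mob u z‖ ^ 2 + 1) = ‖z‖ ^ 2 + 1 := by
    have h1 : ‖den u z‖ ^ 2 * (‖mob u z‖ ^ 2 + 1) =
        ‖u 0 0 * z + u 1 0‖ ^ 2 + ‖u 0 1 * z + u 1 1‖ ^ 2 := by
      have : ‖mob u z‖ = ‖u 0 0 * z + u 1 0‖ / ‖den u z‖ := norm_div _ _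
      rw [this, div_pow, mul_add, mul_div_cancel₀ _ (by positivity), mul_one]
      rfl
    rw [h1]
    have hU := Matrix.mem_unitaryGroup_iff.mp
      (Matrix.specialUnitaryGroup_le_unitaryGroup hu)
    have e00 := congrFun (congrFun hU 0) 0
    have e01 := congrFun (congrFun hU 0) 1
    have e10 := congrFun (congrFun hU 1) 0
    have e11 := congrFun (congrFun hU 1) 1
    simp only [Matrix.mul_apply, Fin.sum_univ_two, Matrix.star_apply, Matrix.one_apply_eq,
      RCLike.star_def, Matrix.one_apply_ne (show (0 : Fin 2) ≠ 1 by decide),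
      Matrix.one_apply_ne (show (1 : Fin 2) ≠ 0 by decide)] at e00 e01 e10 e11
    apply ofReal_injective
    push_cast
    simp only [← mul_conj', map_add, map_mul]
    linear_combination z * (starRingEnd ℂ) z * e00 + z * e01 + (starRingEnd ℂ) z * e10 + e11
  have hs : (‖den u z‖ : ℂ) ^ (I * (ρ : ℂ) - 2 - k) =
      ((‖den u z‖ ^ 2 : ℝ) : ℂ) ^ (I * (ρ : ℂ) / 2 - 1 - k / 2) := by
    rw [show I * (ρ : ℂ) - 2 - k = (2 : ℕ) * (I * (ρ : ℂ) / 2 - 1 - k / 2) by push_cast; ring,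
      cpow_nat_mul, sq ‖den u z‖, ofReal_mul, mul_cpow_ofReal_nonneg hw.le hw.le, sq]
  have hp : (u 0 1 * z + u 1 1) ^ (k - (m : ℕ)) * (u 0 0 * z + u 1 0) ^ (m : ℕ) =
      den u z ^ k * mob u z ^ (m : ℕ) := by
    have e : den u z * mob u z = u 0 0 * z + u 1 0 := by rw [mob, mul_div_cancel₀ _ hz]
    rw [← e, mul_pow, ← mul_assoc]
    congr 1
    change den u z ^ _ * _ = _
    rw [← pow_add, Nat.sub_add_cancel (Nat.lt_succ_iff.mp m.2)]
  rw [actFun, chi, canonFun, hs, ← hN, ofReal_mul,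
    mul_cpow_ofReal_nonneg (by positivity) (by positivity), mul_comm (_ ^ (m : ℕ)), hp]
  ring

/-- The orthogonal projection `P_k` of `H_{(k, ρ)}` onto `H_k`. -/
def projK (k : ℕ) (ρ : ℝ) : PSpace →L[ℂ] PSpace := (spinSubspace k ρ).starProjection

/-! ### The trace and the face weight -/

/-- The trace `∑ᵢ ⟨bᵢ, A bᵢ⟩` of an operator with respect to a Hilbert basis. -/
def traceIn {ι : Type*} (b : HilbertBasis ι ℂ PSpace) (A : PSpace →L[ℂ] PSpace) : ℂ :=
  ∑' i, ⟪b i, A (b i)⟫_ℂ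

/-- The trace of an operator on `H_{(k, ρ)}`, in some Hilbert basis. -/
def hilbertTrace (A : PSpace →L[ℂ] PSpace) : ℂ :=
  traceIn (exists_hilbertBasis ℂ PSpace).choose_spec.choose A

theorem hasSum_trace_finiteRank {ι : Type*} (b : HilbertBasis ι ℂ PSpace)
    (A : PSpace →L[ℂ] PSpace) [FiniteDimensional ℂ A.range] :
    HasSum (fun i => ⟪b i, A (b i)⟫_ℂ)
      (∑ j, ⟪(stdOrthonormalBasis ℂ A.range j : PSpace),
        A (stdOrthonormalBasis ℂ A.range j)⟫_ℂ) := by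
  have h := hasSum_sum (s := Finset.univ) fun j _ => b.hasSum_inner_mul_inner
    (ContinuousLinearMap.adjoint A (stdOrthonormalBasis ℂ A.range j))
    (stdOrthonormalBasis ℂ A.range j : PSpace)
  simp only [ContinuousLinearMap.adjoint_inner_left] at h
  refine (congrArg (HasSum · _) (funext fun i => ?_)).mpr h
  have hx := (stdOrthonormalBasis ℂ A.range).sum_repr' ⟨A (b i), ⟨b i, rfl⟩⟩
  have hx' := congrArg (fun x : A.range => ⟪b i, (x : PSpace)⟫_ℂ) hx
  simp only [Submodule.coe_sum, Submodule.coe_smul, inner_sum, inner_smul_right,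
    Submodule.coe_inner] at hx'
  exact hx'.symm

/-- For a finite-rank operator the sum defining the trace converges in every Hilbert basis, to a
value that does not depend on the basis. -/
theorem hasSum_hilbertTrace {ι : Type*} (b : HilbertBasis ι ℂ PSpace) (A : PSpace →L[ℂ] PSpace)
    [FiniteDimensional ℂ A.range] : HasSum (fun i => ⟪b i, A (b i)⟫_ℂ) (hilbertTrace A) := by
  rw [hilbertTrace, traceIn, (hasSum_trace_finiteRank _ A).tsum_eq]
  exact hasSum_trace_finiteRank b A

/-- The ordered product `∏_{v ∈ ∂h} P_k D^{(k, ρ)}(g_{ve}⁻¹ g_{ve'}) P_k` around a face with `n`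
vertices: `gIn i` and `gOut i` are the group variables `g_{ve}` and `g_{ve'}` at the `i`-th vertex
`v` of the boundary, `e` being the edge that enters `v` and `e'` the one that leaves it. -/
def faceOperator (k : ℕ) (ρ : ℝ) {n : ℕ} (gIn gOut : Fin n → SL(2, ℂ)) : PSpace →L[ℂ] PSpace :=
  (List.ofFn fun i => projK k ρ *
    ((principalSeries k ρ ((gIn i)⁻¹ * gOut i)).toContinuousLinearEquiv : PSpace →L[ℂ] PSpace) *
    projK k ρ).prod

/-- The weight `ζ_k = λ d_k Tr_{(k, ρ)} [∏ P_k g_{ve}⁻¹ g_{ve'} P_k]` of an internal face, with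
`d_k = k + 1` and `ρ = γ (k + 2)`. -/
def zeta (lam γ : ℝ) (k : ℕ) {n : ℕ} (gIn gOut : Fin n → SL(2, ℂ)) : ℂ :=
  lam * (k + 1) * hilbertTrace (faceOperator k (γ * (k + 2)) gIn gOut)

end Spinfoam

end

namespace Spinfoam

/-! The face operator is a product of contractions `P D(g) P`, so it is a contraction with range in
the `(k + 1)`-dimensional space `H_k`. Each diagonal entry in an orthonormal basis of `H_k` has
modulus at most 1, which bounds the trace by `k + 1`.

If the bound is attained, the operator is a unimodular scalar on `H_k`
(`eq_smul_of_norm_hilbertTrace_eq`), hence isometric there, and peeling off factors shows every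
group element to be unitary (`mem_su_of_norm_prod_compress`). The core is `mem_su_of_psOp_mem`: if
`D(g)` maps `H_k` into itself, then `(|z|² + 1) ^ (k + 2)` equals `|(z, 1) g|⁴` times a sum of
squared moduli of polynomials. On real lines through the origin this is a divisibility of
polynomials, and it forces `g g* = 1`. For unitary elements the projections disappear, the product
acts as `D` of the product, and a scalar action on `H_k` with `k ≥ 1` leaves only `± 1`. The
converse is a direct evaluation. -/

/-! ### Real quadratics dividing a power of `t² + 1` -/

open Polynomial in
/-- If the square of a real quadratic divides a power of `t² + 1`, the quadratic is a multiple of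
`t² + 1`. -/
theorem quadratic_eq_of_sq_mul_eq {α β δ : ℝ} (hα : 0 < α) (n : ℕ) (Q : ℂ[X])
    (h : ∀ t : ℝ, ((t : ℂ) ^ 2 + 1) ^ n = (α * (t : ℂ) ^ 2 + β * t + δ) ^ 2 * Q.eval (t : ℂ)) :
    α = δ ∧ β = 0 := by
  have hpoly : ((X : ℂ[X]) ^ 2 + 1) ^ n =
      (C (α : ℂ) * X ^ 2 + C (β : ℂ) * X + C (δ : ℂ)) ^ 2 * Q := by
    refine Polynomial.eq_of_infinite_eval_eq _ _ ?_
    refine (Set.infinite_range_of_injective ofReal_injective).mono ?_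
    rintro _ ⟨t, rfl⟩
    simpa using h t
  have hα' : (α : ℂ) ≠ 0 := ofReal_ne_zero.mpr hα.ne'
  -- Any complex root of the quadratic is a root of `t² + 1`, hence `± I`. Since the coefficients
  -- are real, the real and imaginary parts of the equation at `± I` give both conclusions.
  obtain ⟨z, hz⟩ := IsAlgClosed.exists_root
    (C (α : ℂ) * X ^ 2 + C (β : ℂ) * X + C (δ : ℂ)) (by rw [degree_quadratic hα']; decide)
  have hz' : (α : ℂ) * z ^ 2 + β * z + δ = 0 := by simpa [IsRoot] using hz
  have h1 : z ^ 2 + 1 = 0 := by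
    have := congrArg (eval z) hpoly
    simp only [eval_pow, eval_add, eval_X, eval_one, eval_mul, eval_C, hz'] at this
    exact eq_zero_of_pow_eq_zero (n := n) (by simpa using this)
  have h2 : (z - I) * (z + I) = 0 := by linear_combination h1 - I_sq
  rcases mul_eq_zero.mp h2 with h3 | h3
  · obtain rfl : z = I := by linear_combination h3
    have hre := congrArg re hz'
    have him := congrArg im hz'
    simp at hre him
    exact ⟨by linarith, him⟩
  · obtain rfl : z = -I := by linear_combination h3
    have hre := congrArg re hz'
    have him := congrArg im hz'
    simp at hre him
    exact ⟨by linarith, him⟩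

/-! ### Polynomial description of the spin subspace -/

/-- The common factor `(|z|² + 1) ^ (iρ/2 - 1 - k/2)` of the functions in `H_k`. -/
noncomputable def weight (k : ℕ) (ρ : ℝ) (z : ℂ) : ℂ :=
  ((‖z‖ ^ 2 + 1 : ℝ) : ℂ) ^ (I * ρ / 2 - 1 - k / 2)

theorem weight_ne_zero (k : ℕ) (ρ : ℝ) (z : ℂ) : weight k ρ z ≠ 0 := by
  rw [weight, Ne, cpow_eq_zero_iff, not_and_or]
  exact Or.inl (ofReal_ne_zero.mpr (by positivity))

/-- The parameter `ρ` contributes only a phase. -/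
theorem norm_weight_sq (k : ℕ) (ρ : ℝ) (z : ℂ) :
    ‖weight k ρ z‖ ^ 2 = ((‖z‖ ^ 2 + 1) ^ (k + 2))⁻¹ := by
  have h : 0 < ‖z‖ ^ 2 + 1 := by positivity
  have hre : (I * (ρ : ℂ) / 2 - 1 - k / 2).re = -1 - k / 2 := by simp
  rw [weight, norm_cpow_eq_rpow_re_of_pos h, hre, ← Real.rpow_mul_natCast h.le,
    ← Real.rpow_natCast _ (k + 2), ← Real.rpow_neg h.le]
  congr 1
  push_cast
  ring

/-- The vector `z ^ m` (times the weight) of `H_k`. -/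
noncomputable def canonVec (k : ℕ) (ρ : ℝ) (m : Fin (k + 1)) : PSpace :=
  (memLp_canonFun k ρ m).toLp

theorem canonVec_coeFn (k : ℕ) (ρ : ℝ) (m : Fin (k + 1)) :
    canonVec k ρ m =ᵐ[volume] fun z => weight k ρ z * z ^ (m : ℕ) :=
  MemLp.coeFn_toLp _

theorem canonVec_mem (k : ℕ) (ρ : ℝ) (m : Fin (k + 1)) : canonVec k ρ m ∈ spinSubspace k ρ :=
  Submodule.subset_span ⟨m, rfl⟩

theorem sum_canonVec_coeFn (k : ℕ) (ρ : ℝ) (c : Fin (k + 1) → ℂ) :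
    (∑ m, c m • canonVec k ρ m : PSpace) =ᵐ[volume]
      fun z => weight k ρ z * ∑ m, c m * z ^ (m : ℕ) := by
  have h : ∀ m, (c m • canonVec k ρ m : PSpace) =ᵐ[volume]
      fun z => c m * (weight k ρ z * z ^ (m : ℕ)) := fun m => by
    filter_upwards [Lp.coeFn_smul (c m) (canonVec k ρ m), canonVec_coeFn k ρ m] with z h1 h2
    rw [h1, Pi.smul_apply, h2, smul_eq_mul]
  filter_upwards [Lp.coeFn_finsetSum Finset.univ fun m => c m • canonVec k ρ m,
    Filter.eventually_all.mpr h] with z h1 h2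
  rw [h1, Finset.sum_apply, Finset.mul_sum]
  refine Finset.sum_congr rfl fun m _ => ?_
  rw [h2 m]
  ring

/-- No degree bound is kept: the unitarity argument needs only some polynomial. -/
theorem exists_poly_of_mem (k : ℕ) (ρ : ℝ) {f : PSpace} (hf : f ∈ spinSubspace k ρ) :
    ∃ p : Polynomial ℂ, f =ᵐ[volume] fun z => weight k ρ z * p.eval z := by
  obtain ⟨c, rfl⟩ := (Submodule.mem_span_range_iff_exists_fun ℂ).mp hf
  refine ⟨∑ m, Polynomial.C (c m) * Polynomial.X ^ (m : ℕ), ?_⟩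
  filter_upwards [sum_canonVec_coeFn k ρ c] with z hz
  rw [Polynomial.eval_finsetSum]
  simpa [canonVec] using hz

theorem mem_of_poly (k : ℕ) (ρ : ℝ) {f : PSpace} {p : Polynomial ℂ} (hp : p.natDegree ≤ k)
    (hf : f =ᵐ[volume] fun z => weight k ρ z * p.eval z) : f ∈ spinSubspace k ρ := by
  have : f = ∑ m : Fin (k + 1), p.coeff m • canonVec k ρ m := by
    ext1
    filter_upwards [hf, sum_canonVec_coeFn k ρ fun m => p.coeff m] with z h1 h2
    rw [h1, h2, Polynomial.eval_eq_sum_range' (Nat.lt_succ_of_le hp), Fin.sum_univ_eq_sum_range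
      (fun i => p.coeff i * z ^ i)]
  rw [this]
  exact Submodule.sum_mem _ fun m _ => Submodule.smul_mem _ _ (canonVec_mem k ρ m)

/-- Two continuous functions whose products with the weight agree almost everywhere are equal. -/
theorem eq_of_weight_mul_ae_eq {k : ℕ} {ρ : ℝ} {f g : ℂ → ℂ} (hf : Continuous f)
    (hg : Continuous g)
    (h : (fun z => weight k ρ z * f z) =ᵐ[volume] fun z => weight k ρ z * g z) : f = g := by
  refine (Continuous.ae_eq_iff_eq volume hf hg).mp ?_
  filter_upwards [h] with z hz
  exact mul_left_cancel₀ (weight_ne_zero k ρ z) hz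

theorem linearIndependent_canonVec (k : ℕ) (ρ : ℝ) :
    LinearIndependent ℂ (canonVec k ρ) := by
  rw [Fintype.linearIndependent_iff]
  intro c hc m
  have h := sum_canonVec_coeFn k ρ c
  rw [hc] at h
  have h0 : (fun z : ℂ => ∑ m, c m * z ^ (m : ℕ)) = fun _ => 0 := by
    refine eq_of_weight_mul_ae_eq (k := k) (ρ := ρ) (by fun_prop) continuous_const ?_
    filter_upwards [h, Lp.coeFn_zero ℂ 2 (volume : Measure ℂ)] with z h1 h2
    rw [← h1, h2]
    simp
  have hp : ∑ m : Fin (k + 1), Polynomial.C (c m) * Polynomial.X ^ (m : ℕ) = 0 := by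
    refine Polynomial.funext fun z => ?_
    rw [Polynomial.eval_finsetSum]
    simpa using congrFun h0 z
  have := congrArg (fun p => p.coeff (m : ℕ)) hp
  simpa [Polynomial.finsetSum_coeff, Polynomial.coeff_X_pow, Fin.val_inj] using this

theorem finrank_spinSubspace (k : ℕ) (ρ : ℝ) : Module.finrank ℂ (spinSubspace k ρ) = k + 1 := by
  exact (finrank_span_eq_card (linearIndependent_canonVec k ρ)).trans (Fintype.card_fin _)

/-! ### Elements that preserve the spin subspace -/

theorem psOp_canonVec_coeFn (k : ℕ) (ρ : ℝ) (g : SL(2, ℂ)) (m : Fin (k + 1)) :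
    psOp k ρ g (canonVec k ρ m) =ᵐ[volume] actFun k ρ g (canonFun k ρ m) :=
  (psOp_coeFn k ρ g _).trans (actFun_congr k ρ g (MemLp.coeFn_toLp _))

theorem psOp_canonVec_of_mem_su (k : ℕ) (ρ : ℝ) {u : SL(2, ℂ)}
    (hu : (u : Matrix (Fin 2) (Fin 2) ℂ) ∈ Matrix.specialUnitaryGroup (Fin 2) ℂ)
    (m : Fin (k + 1)) :
    psOp k ρ u (canonVec k ρ m) =ᵐ[volume] fun z => weight k ρ z *
      ((u 0 0 * z + u 1 0) ^ (m : ℕ) * (u 0 1 * z + u 1 1) ^ (k - (m : ℕ))) := by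
  filter_upwards [psOp_canonVec_coeFn k ρ u m, ae_den_ne_zero u] with z h hz
  rw [h, actFun_canonFun k ρ u hu m hz, weight]

open Polynomial in
theorem psOp_mem_of_mem_su (k : ℕ) (ρ : ℝ) {u : SL(2, ℂ)}
    (hu : (u : Matrix (Fin 2) (Fin 2) ℂ) ∈ Matrix.specialUnitaryGroup (Fin 2) ℂ)
    {f : PSpace} (hf : f ∈ spinSubspace k ρ) : psOp k ρ u f ∈ spinSubspace k ρ := by
  suffices h : spinSubspace k ρ ≤ (spinSubspace k ρ).comap (psOp k ρ u).toLinearMap from h hf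
  refine Submodule.span_le.mpr ?_
  rintro _ ⟨m, rfl⟩
  refine mem_of_poly k ρ (p := (C (u 0 0) * X + C (u 1 0)) ^ (m : ℕ) *
    (C (u 0 1) * X + C (u 1 1)) ^ (k - (m : ℕ))) ?_ ?_
  · refine natDegree_mul_le.trans ((add_le_add
      (natDegree_pow_le_of_le _ natDegree_linear_le)
      (natDegree_pow_le_of_le _ natDegree_linear_le)).trans ?_)
    -- `m ≤ k` makes the truncated subtraction exact, so the degrees add up to `k`.
    have := m.2
    omega
  · filter_upwards [psOp_canonVec_of_mem_su k ρ hu m] with z hz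
    simp only [eval_mul, eval_pow, eval_add, eval_C, eval_X]
    exact hz

/-- With `w = mob g z`, the binomial weights turn the sum of `|w| ^ (2 m)` into `(|w|² + 1) ^ k`.
This cancels all but two of the `k + 2` powers in the squared weight, and `|χ|² = |den g z|⁻⁴`
completes the rest to `|(z, 1) g|⁻⁴`. -/
theorem sum_norm_actFun_canonFun_sq (k : ℕ) (ρ : ℝ) (g : SL(2, ℂ)) {z : ℂ} (hz : den g z ≠ 0) :
    ∑ m : Fin (k + 1), (k.choose m : ℝ) * ‖actFun k ρ g (canonFun k ρ m) z‖ ^ 2 =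
      ((‖g 0 0 * z + g 1 0‖ ^ 2 + ‖g 0 1 * z + g 1 1‖ ^ 2) ^ 2)⁻¹ := by
  have hw : 0 < ‖den g z‖ := norm_pos_iff.mpr hz
  have h1 : ‖g 0 0 * z + g 1 0‖ ^ 2 + ‖g 0 1 * z + g 1 1‖ ^ 2 =
      ‖den g z‖ ^ 2 * (‖mob g z‖ ^ 2 + 1) := by
    have : ‖mob g z‖ = ‖g 0 0 * z + g 1 0‖ / ‖den g z‖ := norm_div _ _
    rw [this, div_pow, mul_add, mul_div_cancel₀ _ (by positivity), mul_one]
    rfl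
  have h2 : ∀ m : Fin (k + 1), (k.choose m : ℝ) * ‖actFun k ρ g (canonFun k ρ m) z‖ ^ 2 =
      ((‖den g z‖ ^ 2)⁻¹ ^ 2 * ((‖mob g z‖ ^ 2 + 1) ^ (k + 2))⁻¹) *
        ((‖mob g z‖ ^ 2) ^ (m : ℕ) * (k.choose m : ℝ)) := fun m => by
    have : canonFun k ρ m (mob g z) = weight k ρ (mob g z) * mob g z ^ (m : ℕ) := rfl
    rw [actFun, this, norm_mul, norm_mul, mul_pow, mul_pow, norm_chi k ρ hz, norm_weight_sq,
      norm_pow]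
    ring
  have h3 : ∑ m : Fin (k + 1), (‖mob g z‖ ^ 2) ^ (m : ℕ) * (k.choose m : ℝ) =
      (‖mob g z‖ ^ 2 + 1) ^ k := by
    rw [add_pow, Fin.sum_univ_eq_sum_range (fun i => (‖mob g z‖ ^ 2) ^ i * (k.choose i : ℝ))]
    simp
  have h4 : 0 < ‖mob g z‖ ^ 2 + 1 := by positivity
  rw [Finset.sum_congr rfl fun m _ => h2 m, ← Finset.mul_sum, h3, h1]
  field_simp
  ring

open Polynomial in
/-- An element of `SL(2, ℂ)` that maps `H_k` into itself is unitary. -/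
theorem mem_su_of_psOp_mem (k : ℕ) (ρ : ℝ) {g : SL(2, ℂ)}
    (hg : ∀ f ∈ spinSubspace k ρ, psOp k ρ g f ∈ spinSubspace k ρ) :
    (g : Matrix (Fin 2) (Fin 2) ℂ) ∈ Matrix.specialUnitaryGroup (Fin 2) ℂ := by
  choose p hp using fun m => exists_poly_of_mem k ρ (hg _ (canonVec_mem k ρ m))
  have hident : (fun z : ℂ => (‖z‖ ^ 2 + 1) ^ (k + 2)) = fun z =>
      (‖g 0 0 * z + g 1 0‖ ^ 2 + ‖g 0 1 * z + g 1 1‖ ^ 2) ^ 2 *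
        ∑ m : Fin (k + 1), (k.choose m : ℝ) * ‖(p m).eval z‖ ^ 2 := by
    refine (Continuous.ae_eq_iff_eq volume (by fun_prop) (by fun_prop)).mp ?_
    filter_upwards [Filter.eventually_all.mpr hp,
      Filter.eventually_all.mpr fun m => psOp_canonVec_coeFn k ρ g m,
      ae_den_ne_zero g] with z h1 h2 hz
    have hsum := sum_norm_actFun_canonFun_sq k ρ g hz
    simp only [← h2, h1, norm_mul, mul_pow, norm_weight_sq] at hsum
    simp only [mul_left_comm _ (((‖z‖ ^ 2 + 1) ^ (k + 2))⁻¹)] at hsum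
    rw [← Finset.mul_sum] at hsum
    have hpos : 0 < ‖g 0 0 * z + g 1 0‖ ^ 2 + ‖g 0 1 * z + g 1 1‖ ^ 2 := by
      have : 0 < ‖g 0 1 * z + g 1 1‖ := norm_pos_iff.mpr hz
      positivity
    have hpos' : 0 < ‖z‖ ^ 2 + 1 := by positivity
    rw [inv_mul_eq_iff_eq_mul₀ (by positivity)] at hsum
    rw [hsum, mul_left_comm, mul_inv_cancel₀ (by positivity), mul_one]
  -- `α`, `δ` and `B` are the entries of `g g*`, and `|(z, 1) g|² = α |z|² + 2 Re (B z) + δ`.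
  set α : ℝ := ‖g 0 0‖ ^ 2 + ‖g 0 1‖ ^ 2 with hα
  set δ : ℝ := ‖g 1 0‖ ^ 2 + ‖g 1 1‖ ^ 2 with hδ
  set B : ℂ := g 0 0 * starRingEnd ℂ (g 1 0) + g 0 1 * starRingEnd ℂ (g 1 1) with hB
  have hdet := det_eq g
  have hαpos : 0 < α := by
    by_contra! h
    have h0 : g 0 0 = 0 := norm_eq_zero.mp (by nlinarith [norm_nonneg (g 0 0), norm_nonneg (g 0 1)])
    have h1 : g 0 1 = 0 := norm_eq_zero.mp (by nlinarith [norm_nonneg (g 0 0), norm_nonneg (g 0 1)])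
    simp [h0, h1] at hdet
  -- On the line `z = t u` with `t` real, the conjugate of a polynomial value is again a polynomial
  -- in `t`, with conjugated coefficients. The identity `hident` thus becomes polynomial in `t`.
  have key : ∀ u : ℂ, ‖u‖ = 1 → α = δ ∧ 2 * (B * u).re = 0 := by
    intro u hu
    have huu : u * starRingEnd ℂ u = 1 := by rw [mul_conj', hu]; simp
    refine quadratic_eq_of_sq_mul_eq hαpos (k + 2)
      (∑ m : Fin (k + 1), C (k.choose m : ℂ) * ((p m).comp (C u * X) *
        ((p m).map (starRingEnd ℂ)).comp (C (starRingEnd ℂ u) * X))) fun t => ?_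
    have h := congrArg (ofReal : ℝ → ℂ) (congrFun hident (t * u))
    have hconj : ∀ q : ℂ[X], starRingEnd ℂ (q.eval (t * u)) =
        (q.map (starRingEnd ℂ)).eval (starRingEnd ℂ u * t) := fun q => by
      rw [eval_map, ← eval₂_at_apply, map_mul, conj_ofReal, mul_comm]
    have hre : ((2 * (B * u).re : ℝ) : ℂ) = B * u + starRingEnd ℂ (B * u) := by
      rw [add_conj]
    push_cast at h
    simp only [← mul_conj', map_add, map_mul, conj_ofReal, hconj] at h
    rw [eval_finsetSum]
    simp only [eval_mul, eval_comp, eval_C, eval_X]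
    have hN₀ : (t : ℂ) ^ 2 + 1 = t * u * (t * starRingEnd ℂ u) + 1 := by
      linear_combination -(t : ℂ) ^ 2 * huu
    have hN : (α : ℂ) * t ^ 2 + (B * u + starRingEnd ℂ (B * u)) * t + δ =
        (g 0 0 * (t * u) + g 1 0) *
            (starRingEnd ℂ (g 0 0) * (t * starRingEnd ℂ u) + starRingEnd ℂ (g 1 0)) +
          (g 0 1 * (t * u) + g 1 1) *
            (starRingEnd ℂ (g 0 1) * (t * starRingEnd ℂ u) + starRingEnd ℂ (g 1 1)) := by
      rw [hα, hδ, hB]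
      push_cast
      simp only [← mul_conj', map_add, map_mul, conj_conj]
      linear_combination -(t : ℂ) ^ 2 * (g 0 0 * starRingEnd ℂ (g 0 0) +
        g 0 1 * starRingEnd ℂ (g 0 1)) * huu
    rw [hre, hN₀, hN, mul_comm u (t : ℂ)]
    exact h
  -- The directions `1` and `I` detect the real and the imaginary part of `B`.
  obtain ⟨hαδ, hB1⟩ := key 1 (by simp)
  obtain ⟨-, hB2⟩ := key I (by simp)
  have hB0 : B = 0 := by
    apply Complex.ext <;> simp at hB1 hB2 ⊢ <;> linarith
  -- This is `det (g g*) = |det g|² = 1`. With `B = 0` and `α = δ > 0` it forces `α = 1`.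
  have e : (α : ℂ) * δ - B * starRingEnd ℂ B = 1 := by
    rw [hα, hδ, hB]
    push_cast
    simp only [← mul_conj', map_add, map_mul, conj_conj]
    have hdet' := congrArg (starRingEnd ℂ) hdet
    simp only [map_sub, map_mul, map_one] at hdet'
    linear_combination hdet' * (g 0 0 * g 1 1 - g 0 1 * g 1 0) + hdet
  have hα1 : α = 1 := by
    rw [hB0, ← hαδ, zero_mul, sub_zero] at e
    have e' : α * α = 1 := by exact_mod_cast e
    nlinarith
  have hδ1 : δ = 1 := hαδ ▸ hα1
  have e00 : g 0 0 * starRingEnd ℂ (g 0 0) + g 0 1 * starRingEnd ℂ (g 0 1) = 1 := by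
    simp only [mul_conj']
    exact_mod_cast hα1
  have e11 : g 1 0 * starRingEnd ℂ (g 1 0) + g 1 1 * starRingEnd ℂ (g 1 1) = 1 := by
    simp only [mul_conj']
    exact_mod_cast hδ1
  have e10 : g 1 0 * starRingEnd ℂ (g 0 0) + g 1 1 * starRingEnd ℂ (g 0 1) = 0 := by
    have := congrArg (starRingEnd ℂ) hB0
    simp only [hB, map_add, map_mul, conj_conj, map_zero] at this
    linear_combination this
  refine Matrix.mem_specialUnitaryGroup_iff.mpr ⟨Matrix.mem_unitaryGroup_iff.mpr ?_, g.det_coe⟩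
  ext i j
  fin_cases i <;> fin_cases j <;>
    simp [Matrix.mul_apply, Fin.sum_univ_two, Matrix.star_apply, e00, e11, e10, ← hB, hB0]

/-- The vectors `m = 0` and `m = k` force `u` to be diagonal, and `m = 1`, available since `k ≥ 1`,
makes the diagonal entries equal. The determinant then fixes the sign. -/
theorem eq_one_or_neg_one_of_psOp_eq_smul (k : ℕ) (hk : 1 ≤ k) (ρ : ℝ) {u : SL(2, ℂ)}
    (hu : (u : Matrix (Fin 2) (Fin 2) ℂ) ∈ Matrix.specialUnitaryGroup (Fin 2) ℂ) {c : ℂ}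
    (hc : c ≠ 0) (h : ∀ f ∈ spinSubspace k ρ, psOp k ρ u f = c • f) : u = 1 ∨ u = -1 := by
  have key : ∀ (m : Fin (k + 1)) (z : ℂ),
      (u 0 0 * z + u 1 0) ^ (m : ℕ) * (u 0 1 * z + u 1 1) ^ (k - (m : ℕ)) =
        c * z ^ (m : ℕ) := fun m => by
    refine congrFun (eq_of_weight_mul_ae_eq (k := k) (ρ := ρ) (by fun_prop) (by fun_prop) ?_)
    filter_upwards [psOp_canonVec_of_mem_su k ρ hu m, canonVec_coeFn k ρ m,
      Lp.coeFn_smul c (canonVec k ρ m)] with z h1 h2 h3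
    rw [← h1, h _ (canonVec_mem k ρ m), h3, Pi.smul_apply, h2, smul_eq_mul]
    ring
  have hk0 : k ≠ 0 := by omega
  have h0 : ∀ z, (u 0 1 * z + u 1 1) ^ k = c := fun z => by simpa using key 0 z
  have hdet := det_eq u
  have h10 : u 1 0 = 0 := by
    have := key (Fin.last k) 0
    simpa [hk0] using this
  have h11 : u 1 1 ^ k = c := by simpa using h0 0
  have h01 : u 0 1 = 0 := by
    by_contra hb
    have := h0 (-u 1 1 / u 0 1)
    rw [mul_div_cancel₀ _ hb] at this
    simp [hk0] at this
    exact hc this.symm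
  have h00 : u 0 0 = u 1 1 := by
    have := key ⟨1, by omega⟩ 1
    simp only [h10, h01, mul_one, add_zero, pow_one, zero_add] at this
    rw [← h11, ← Nat.sub_add_cancel hk, pow_succ, Nat.add_sub_cancel, mul_comm] at this
    refine mul_left_cancel₀ (pow_ne_zero (k - 1) ?_) this
    rintro h
    simp [h, h01] at hdet
  have hsq : (u 1 1 - 1) * (u 1 1 + 1) = 0 := by
    rw [h00, h01] at hdet
    linear_combination hdet
  rcases mul_eq_zero.mp hsq with h | h
  · left
    ext i j
    fin_cases i <;> fin_cases j <;> simp [h10, h01, h00] <;> linear_combination h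
  · right
    ext i j
    fin_cases i <;> fin_cases j <;> simp [h10, h01, h00] <;> linear_combination h

/-! ### Traces of contractions -/

/-- The trace of an operator with range in a finite-dimensional subspace can be computed in an
orthonormal basis of the subspace. -/
theorem hilbertTrace_eq_sum (S : Submodule ℂ PSpace) [FiniteDimensional ℂ S]
    (A : PSpace →L[ℂ] PSpace) (hA : ∀ f, A f ∈ S) :
    hilbertTrace A = ∑ j, ⟪(stdOrthonormalBasis ℂ S j : PSpace),
      A (stdOrthonormalBasis ℂ S j)⟫_ℂ := by
  set b := (exists_hilbertBasis ℂ PSpace).choose_spec.choose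
  -- Parseval in `b` for each pair `(A* e_j, e_j)`. The sum over `j` is finite, and at fixed `i` it
  -- reassembles `A (b i)` from its components in `S`.
  have h := hasSum_sum (s := Finset.univ) fun j _ => b.hasSum_inner_mul_inner
    (ContinuousLinearMap.adjoint A (stdOrthonormalBasis ℂ S j)) (stdOrthonormalBasis ℂ S j : PSpace)
  simp only [ContinuousLinearMap.adjoint_inner_left] at h
  refine HasSum.tsum_eq ((congrArg (HasSum · _) (funext fun i => ?_)).mpr h)
  have hx := (stdOrthonormalBasis ℂ S).sum_repr' ⟨A (b i), hA _⟩
  have hx' := congrArg (fun x : S => ⟪b i, (x : PSpace)⟫_ℂ) hx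
  simp only [Submodule.coe_sum, Submodule.coe_smul, inner_sum, inner_smul_right,
    Submodule.coe_inner] at hx'
  exact hx'.symm

theorem norm_stdOrthonormalBasis_coe (S : Submodule ℂ PSpace) [FiniteDimensional ℂ S]
    (j : Fin (Module.finrank ℂ S)) : ‖(stdOrthonormalBasis ℂ S j : PSpace)‖ = 1 :=
  (stdOrthonormalBasis ℂ S).norm_eq_one j

theorem norm_hilbertTrace_le (S : Submodule ℂ PSpace) [FiniteDimensional ℂ S]
    (A : PSpace →L[ℂ] PSpace) (hA : ∀ f, A f ∈ S) (hn : ∀ f, ‖A f‖ ≤ ‖f‖) :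
    ‖hilbertTrace A‖ ≤ Module.finrank ℂ S := by
  rw [hilbertTrace_eq_sum S A hA]
  refine (norm_sum_le _ _).trans ((Finset.sum_le_sum fun j _ => ?_).trans_eq
    (b := ∑ _j : Fin (Module.finrank ℂ S), (1 : ℝ)) (by simp))
  refine (norm_inner_le_norm _ _).trans ?_
  rw [norm_stdOrthonormalBasis_coe, one_mul, ← norm_stdOrthonormalBasis_coe S j]
  exact hn _

/-- A contraction into `S` whose trace has the maximal modulus `dim S` is a scalar of modulus one
on `S`. -/
theorem eq_smul_of_norm_hilbertTrace_eq (S : Submodule ℂ PSpace) [FiniteDimensional ℂ S]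
    (hS : 0 < Module.finrank ℂ S)
    (A : PSpace →L[ℂ] PSpace) (hA : ∀ f, A f ∈ S) (hn : ∀ f, ‖A f‖ ≤ ‖f‖)
    (htr : ‖hilbertTrace A‖ = Module.finrank ℂ S) :
    ∃ c : ℂ, ‖c‖ = 1 ∧ ∀ f ∈ S, A f = c • f := by
  set e := stdOrthonormalBasis ℂ S
  have hS0 : (Module.finrank ℂ S : ℝ) ≠ 0 := by positivity
  set c : ℂ := hilbertTrace A / Module.finrank ℂ S with hc
  have hc1 : ‖c‖ = 1 := by rw [hc, norm_div, htr, norm_natCast, div_self hS0]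
  have hτ : hilbertTrace A = Module.finrank ℂ S * c := by
    rw [hc, mul_div_cancel₀]
    exact_mod_cast hS0
  have hnorm : ∀ j, ‖(e j : PSpace)‖ = 1 := norm_stdOrthonormalBasis_coe S
  -- As `c` is the mean of the diagonal entries and `|c| = 1`, these bounds sum to zero, so every
  -- deviation from the scalar `c` vanishes.
  have hterm : ∀ j, ‖A (e j) - c • (e j : PSpace)‖ ^ 2 ≤
      2 - 2 * (starRingEnd ℂ c * ⟪(e j : PSpace), A (e j)⟫_ℂ).re := fun j => by
    have h1 : ‖A (e j)‖ ≤ 1 := (hn _).trans_eq (hnorm j)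
    have h2 := norm_sub_sq (𝕜 := ℂ) (A (e j)) (c • (e j : PSpace))
    rw [norm_smul, hc1, hnorm, ← inner_re_symm, inner_smul_left] at h2
    rw [h2, RCLike.re_eq_complex_re]
    nlinarith [norm_nonneg (A (e j))]
  have hsum : ∑ j, ‖A (e j) - c • (e j : PSpace)‖ ^ 2 ≤ 0 := by
    refine (Finset.sum_le_sum fun j _ => hterm j).trans_eq ?_
    rw [Finset.sum_sub_distrib, ← Finset.mul_sum, ← Complex.re_sum, ← Finset.mul_sum,
      ← hilbertTrace_eq_sum S A hA, hτ, mul_left_comm, mul_comm (starRingEnd ℂ c), mul_conj', hc1]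
    simp [mul_comm]
  have hzero : ∀ j, A (e j) = c • (e j : PSpace) := fun j => by
    have := (Finset.sum_eq_zero_iff_of_nonneg fun j _ => sq_nonneg _).mp
      (le_antisymm hsum (Finset.sum_nonneg fun j _ => sq_nonneg _)) j (Finset.mem_univ j)
    exact sub_eq_zero.mp (norm_eq_zero.mp (pow_eq_zero_iff two_ne_zero |>.mp this))
  refine ⟨c, hc1, fun f hf => ?_⟩
  have hx := congrArg (fun x : S => (x : PSpace)) (e.sum_repr' ⟨f, hf⟩)
  simp only [Submodule.coe_sum, Submodule.coe_smul] at hx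
  rw [← hx, map_sum, Finset.smul_sum]
  refine Finset.sum_congr rfl fun j _ => ?_
  rw [map_smul, hzero, smul_comm]

theorem hilbertTrace_eq_of_eq_smul (S : Submodule ℂ PSpace) [FiniteDimensional ℂ S]
    (A : PSpace →L[ℂ] PSpace) (hA : ∀ f, A f ∈ S) {c : ℂ} (h : ∀ f ∈ S, A f = c • f) :
    hilbertTrace A = Module.finrank ℂ S * c := by
  rw [hilbertTrace_eq_sum S A hA]
  have : ∀ j, ⟪(stdOrthonormalBasis ℂ S j : PSpace), A (stdOrthonormalBasis ℂ S j)⟫_ℂ = c :=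
    fun j => by
      rw [h _ (SetLike.coe_mem _), inner_smul_right, inner_self_eq_norm_sq_to_K,
        norm_stdOrthonormalBasis_coe]
      simp
  simp [this]

/-! ### Products of compressed operators -/

/-- The compression `P_k D(g) P_k`. -/
noncomputable def compress (k : ℕ) (ρ : ℝ) (g : SL(2, ℂ)) : PSpace →L[ℂ] PSpace :=
  projK k ρ *
    ((principalSeries k ρ g).toContinuousLinearEquiv : PSpace →L[ℂ] PSpace) * projK k ρ

theorem compress_apply (k : ℕ) (ρ : ℝ) (g : SL(2, ℂ)) (f : PSpace) :
    compress k ρ g f = projK k ρ (psOp k ρ g (projK k ρ f)) := rfl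

theorem projK_mem (k : ℕ) (ρ : ℝ) (f : PSpace) : projK k ρ f ∈ spinSubspace k ρ :=
  Submodule.starProjection_apply_mem _ f

theorem projK_of_mem (k : ℕ) (ρ : ℝ) {f : PSpace} (hf : f ∈ spinSubspace k ρ) :
    projK k ρ f = f :=
  Submodule.starProjection_eq_self_iff.mpr hf

theorem norm_projK_le (k : ℕ) (ρ : ℝ) (f : PSpace) : ‖projK k ρ f‖ ≤ ‖f‖ :=
  Submodule.norm_starProjection_apply_le _ f

theorem norm_compress_le (k : ℕ) (ρ : ℝ) (g : SL(2, ℂ)) (f : PSpace) :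
    ‖compress k ρ g f‖ ≤ ‖f‖ := by
  rw [compress_apply]
  refine (norm_projK_le _ _ _).trans ?_
  rw [LinearIsometry.norm_map]
  exact norm_projK_le _ _ _

theorem compress_of_mem_su (k : ℕ) (ρ : ℝ) {u : SL(2, ℂ)}
    (hu : (u : Matrix (Fin 2) (Fin 2) ℂ) ∈ Matrix.specialUnitaryGroup (Fin 2) ℂ)
    {f : PSpace} (hf : f ∈ spinSubspace k ρ) : compress k ρ u f = psOp k ρ u f := by
  rw [compress_apply, projK_of_mem k ρ hf, projK_of_mem k ρ (psOp_mem_of_mem_su k ρ hu hf)]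

/-- If the compression of `D(g)` is isometric on `H_k`, then `g` is unitary. -/
theorem mem_su_of_norm_compress (k : ℕ) (ρ : ℝ) {g : SL(2, ℂ)}
    (h : ∀ f ∈ spinSubspace k ρ, ‖compress k ρ g f‖ = ‖f‖) :
    (g : Matrix (Fin 2) (Fin 2) ℂ) ∈ Matrix.specialUnitaryGroup (Fin 2) ℂ := by
  refine mem_su_of_psOp_mem k ρ fun f hf => ?_
  -- `D(g)` is isometric, so the hypothesis says that projecting `D(g) f` loses no norm.
  rw [Submodule.mem_iff_norm_starProjection]
  have := h f hf
  rwa [compress_apply, projK_of_mem k ρ hf, ← (psOp k ρ g).norm_map f] at this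

theorem inv_mem_su {u : SL(2, ℂ)}
    (hu : (u : Matrix (Fin 2) (Fin 2) ℂ) ∈ Matrix.specialUnitaryGroup (Fin 2) ℂ) :
    ((u⁻¹ : SL(2, ℂ)) : Matrix (Fin 2) (Fin 2) ℂ) ∈ Matrix.specialUnitaryGroup (Fin 2) ℂ := by
  have hU := Matrix.mem_unitaryGroup_iff.mp (Matrix.specialUnitaryGroup_le_unitaryGroup hu)
  have h1 : ((u⁻¹ : SL(2, ℂ)) : Matrix (Fin 2) (Fin 2) ℂ) = star (u : Matrix (Fin 2) (Fin 2) ℂ) := by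
    have h2 : ((u⁻¹ : SL(2, ℂ)) : Matrix (Fin 2) (Fin 2) ℂ) * (u : Matrix (Fin 2) (Fin 2) ℂ) = 1 := by
      rw [← Matrix.SpecialLinearGroup.coe_mul, inv_mul_cancel, Matrix.SpecialLinearGroup.coe_one]
    rw [← one_mul (star _), ← h2, mul_assoc, hU, mul_one]
  refine Matrix.mem_specialUnitaryGroup_iff.mpr ⟨?_, (u⁻¹).det_coe⟩
  rw [h1]
  exact Unitary.star_mem (Matrix.specialUnitaryGroup_le_unitaryGroup hu)

theorem list_prod_mem_su {l : List SL(2, ℂ)}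
    (hl : ∀ u ∈ l, (u : Matrix (Fin 2) (Fin 2) ℂ) ∈ Matrix.specialUnitaryGroup (Fin 2) ℂ) :
    (l.prod : Matrix (Fin 2) (Fin 2) ℂ) ∈ Matrix.specialUnitaryGroup (Fin 2) ℂ := by
  induction l with
  | nil => simp
  | cons a l ih =>
    rw [List.prod_cons, Matrix.SpecialLinearGroup.coe_mul]
    exact mul_mem (hl a List.mem_cons_self) (ih fun u hu => hl u (List.mem_cons_of_mem _ hu))

theorem norm_prod_compress_le (k : ℕ) (ρ : ℝ) (l : List SL(2, ℂ)) (f : PSpace) :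
    ‖(l.map (compress k ρ)).prod f‖ ≤ ‖f‖ := by
  induction l with
  | nil => simp
  | cons a l ih =>
    rw [List.map_cons, List.prod_cons]
    exact (norm_compress_le k ρ a _).trans ih

/-- The leftmost projection is applied last. The empty product is the identity and must be excluded.
-/
theorem prod_compress_mem (k : ℕ) (ρ : ℝ) {l : List SL(2, ℂ)} (hl : l ≠ []) (f : PSpace) :
    (l.map (compress k ρ)).prod f ∈ spinSubspace k ρ := by
  cases l with
  | nil => exact absurd rfl hl
  | cons a l =>
    rw [List.map_cons, List.prod_cons]
    exact projK_mem k ρ _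

theorem prod_compress_of_mem_su (k : ℕ) (ρ : ℝ) {l : List SL(2, ℂ)}
    (hl : ∀ u ∈ l, (u : Matrix (Fin 2) (Fin 2) ℂ) ∈ Matrix.specialUnitaryGroup (Fin 2) ℂ)
    {f : PSpace} (hf : f ∈ spinSubspace k ρ) :
    (l.map (compress k ρ)).prod f = psOp k ρ l.prod f := by
  induction l with
  | nil => simp [psOp_one]
  | cons a l ih =>
    have hl' := fun u hu => hl u (List.mem_cons_of_mem a hu)
    rw [List.map_cons, List.prod_cons, List.prod_cons, psOp_mul, mul_apply_eq_comp,
      ih hl', compress_of_mem_su k ρ (hl a List.mem_cons_self)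
        (psOp_mem_of_mem_su k ρ (list_prod_mem_su hl') hf)]

/-- If a product of compressions is isometric on `H_k`, then all group elements are unitary. -/
theorem mem_su_of_norm_prod_compress (k : ℕ) (ρ : ℝ) {l : List SL(2, ℂ)}
    (h : ∀ f ∈ spinSubspace k ρ, ‖(l.map (compress k ρ)).prod f‖ = ‖f‖) :
    ∀ u ∈ l, (u : Matrix (Fin 2) (Fin 2) ℂ) ∈ Matrix.specialUnitaryGroup (Fin 2) ℂ := by
  induction l with
  | nil => simp
  | cons a l ih =>
    simp only [List.map_cons, List.prod_cons, mul_apply_eq_comp] at h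
    -- The head is a contraction, so the tail cannot have shrunk `f`.
    have hl := ih fun f hf => le_antisymm (norm_prod_compress_le k ρ l f)
      ((h f hf).symm.trans_le (norm_compress_le k ρ a _))
    have hp := list_prod_mem_su hl
    intro u hu
    rcases List.mem_cons.mp hu with rfl | hu
    · refine mem_su_of_norm_compress k ρ fun f hf => ?_
      -- The tail is unitary and acts on `H_k` as `D(l.prod)`. Testing on `D(l.prod⁻¹) f` therefore
      -- feeds `f` itself to the head.
      have hf' := psOp_mem_of_mem_su k ρ (inv_mem_su hp) hf
      have := h _ hf'
      rwa [prod_compress_of_mem_su k ρ hl hf', ← psOp_mul, mul_inv_cancel, psOp_one,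
        LinearIsometry.norm_map] at this
    · exact hl u hu

/-- The Möbius map of `-1` is trivial, so only `χ (-1)` remains. -/
theorem psOp_neg_one (k : ℕ) (ρ : ℝ) (f : PSpace) : psOp k ρ (-1) f = (-1 : ℂ) ^ k • f := by
  ext1
  filter_upwards [psOp_coeFn k ρ (-1) f, Lp.coeFn_smul ((-1 : ℂ) ^ k) f] with z h1 h2
  rw [h1, h2]
  simp [actFun, den, mob, chi]

theorem faceOperator_eq_prod (k : ℕ) (ρ : ℝ) {n : ℕ} (gIn gOut : Fin n → SL(2, ℂ)) :
    faceOperator k ρ gIn gOut =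
      ((List.ofFn fun i => (gIn i)⁻¹ * gOut i).map (compress k ρ)).prod := by
  rw [List.map_ofFn]
  rfl

/-- A product of compressions has trace of modulus at most `k + 1`, with equality exactly when all
group elements are unitary and their product is `± 1`. -/
theorem norm_hilbertTrace_prod_compress (k : ℕ) (hk : 1 ≤ k) (ρ : ℝ) {l : List SL(2, ℂ)}
    (hl : l ≠ []) :
    ‖hilbertTrace (l.map (compress k ρ)).prod‖ ≤ (k : ℝ) + 1 ∧
    (‖hilbertTrace (l.map (compress k ρ)).prod‖ = (k : ℝ) + 1 ↔
      (∀ u ∈ l, (u : Matrix (Fin 2) (Fin 2) ℂ) ∈ Matrix.specialUnitaryGroup (Fin 2) ℂ) ∧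
        (l.prod = 1 ∨ l.prod = -1)) := by
  have hd : (Module.finrank ℂ (spinSubspace k ρ) : ℝ) = (k : ℝ) + 1 := by
    rw [finrank_spinSubspace]; push_cast; rfl
  have hmem := prod_compress_mem k ρ hl
  have hle := norm_prod_compress_le k ρ l
  rw [← hd]
  refine ⟨norm_hilbertTrace_le _ _ hmem hle, fun h => ?_, fun ⟨hu, hprod⟩ => ?_⟩
  · obtain ⟨c, hc, hcf⟩ := eq_smul_of_norm_hilbertTrace_eq _
      (by rw [finrank_spinSubspace]; omega) _ hmem hle h
    have hu := mem_su_of_norm_prod_compress k ρ (l := l) fun f hf => by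
      rw [hcf f hf, norm_smul, hc, one_mul]
    refine ⟨hu, eq_one_or_neg_one_of_psOp_eq_smul k hk ρ (list_prod_mem_su hu)
      (c := c) (norm_ne_zero_iff.mp (by simp [hc])) fun f hf => ?_⟩
    rw [← prod_compress_of_mem_su k ρ hu hf, hcf f hf]
  · obtain ⟨c, hc, hcf⟩ : ∃ c : ℂ, ‖c‖ = 1 ∧ ∀ f, psOp k ρ l.prod f = c • f := by
      rcases hprod with h | h
      · exact ⟨1, by simp, fun f => by rw [h, psOp_one, one_smul]⟩
      · exact ⟨(-1) ^ k, by simp, fun f => by rw [h, psOp_neg_one]⟩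
    rw [hilbertTrace_eq_of_eq_smul _ _ hmem (c := c) fun f hf => by
      rw [prod_compress_of_mem_su k ρ hu hf, hcf]]
    rw [norm_mul, hc, mul_one, norm_natCast]

end Spinfoam

/-! ### The bound on the face weight -/

theorem mainTheorem4 (lam : ℝ) (hlam : 0 < lam) (γ : ℝ) (k : ℕ) (hk : 1 ≤ k)
    (n : ℕ) (hn : 1 ≤ n) (gIn gOut : Fin n → SL(2, ℂ)) :
    ‖Spinfoam.zeta lam γ k gIn gOut‖ ≤ lam * ((k : ℝ) + 1) ^ 2 ∧
    (‖Spinfoam.zeta lam γ k gIn gOut‖ = lam * ((k : ℝ) + 1) ^ 2 ↔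
      (∀ i, (((gIn i)⁻¹ * gOut i : SL(2, ℂ)) : Matrix (Fin 2) (Fin 2) ℂ) ∈
          Matrix.specialUnitaryGroup (Fin 2) ℂ) ∧
        ((List.ofFn fun i => (gIn i)⁻¹ * gOut i).prod = 1 ∨
          (List.ofFn fun i => (gIn i)⁻¹ * gOut i).prod = -1)) := by
  have hne : (List.ofFn fun i => (gIn i)⁻¹ * gOut i) ≠ [] := by
    rw [Ne, List.ofFn_eq_nil_iff]
    omega
  obtain ⟨hle, heq⟩ :=
    Spinfoam.norm_hilbertTrace_prod_compress k hk (γ * (k + 2)) hne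
  have hpos : 0 < lam * ((k : ℝ) + 1) := by positivity
  have hcoef : ‖(lam : ℂ) * (k + 1)‖ = lam * ((k : ℝ) + 1) := by
    have : (lam : ℂ) * (k + 1) = ((lam * ((k : ℝ) + 1) : ℝ) : ℂ) := by push_cast; rfl
    rw [this, norm_real, Real.norm_of_nonneg hpos.le]
  rw [Spinfoam.zeta, norm_mul, hcoef, Spinfoam.faceOperator_eq_prod, sq, ← mul_assoc,
    mul_right_inj' hpos.ne', heq, List.forall_mem_ofFn_iff]
  exact ⟨mul_le_mul_of_nonneg_left hle hpos.le, Iff.rfl⟩
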